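/- Let $S$ be an inverse semigroup (inverses written $s^*$) with set of idempotents $E$, and suppose $S$ is quasi-countable: there is a countable $X\subseteq S$ such that $S$ is generated, as an inverse semigroup, by $X\cup E$. Write $s\le t$ for the natural partial order $ss^*t=s$. Let $\hat E_0$ be the set of nonempty filters of the semilattice $E$, put $D_e=\{\xi\in\hat E_0: e\in\xi\}$, and give $\hat E_0$ the topology with basis the sets $D_e\cap D_{e_1}^c\cap\dots\cap D_{e_n}^c$ with $e_1,\dots,e_n<e$. For $\xi\in D_{s^*s}$ put $\theta_s(\xi)=\{e\in E: e\ge sfs^*\text{ for some }f\in\xi\}$. Let $G$ be the universal groupoid of $S$: the set of germs $[s,\xi]$ with $s\in S$, $\xi\in D_{s^*s}$, where $[s,\xi]=[t,\zeta]$ iff $\xi=\zeta$ and $se=te$ for some $e\in\xi$; the source of $[s,\xi]$ is $\xi$ and its range is $\theta_s(\xi)$; $[s,\theta_t(\xi)][t,\xi]=[st,\xi]$ and $[s,\xi]^{-1}=[s^*,\theta_s(\xi)]$; the unit space is $G^{(0)}=\{[e,\xi]:e\in E,\ \xi\in D_e\}$; the sets $\{[s,\xi]:\xi\in U\}$, with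 $s\in S$ and $U\subseteq D_{s^*s}$ open, form a basis of the topology. Suppose that $G$ is Hausdorff. A length function on $S$ is a map $l:S\to[0,\infty)$ with $l(s)=0\iff s\in E$, $l(s^*)=l(s)$ and $l(st)\le l(s)+l(t)$ for all $s,t\in S$. It is uniformly discrete if there is $c>0$ with $l(s)\ge c$ for all $s\notin E$. A finite set $F\subseteq S$ witnesses $r$-properness of $l$ if every $s$ with $0<l(s)\le r$ satisfies $s\le m$ for some $m\in F$; $l$ is proper if such an $F$ exists for every $r\ge0$, and tightly proper if for every $r\ge 0$ there is such an $F$ with moreover $l(m)\le r$ for all $m\in F$. A length function on $G$ is a map $L:G\to[0,\infty)$ with $L(g)=0\iff g\in G^{(0)}$, $L(g^{-1})=L(g)$, and $L(gh)\le L(g)+L(h)$ whenever $g,h$ are composable. It is uniformly discrete if there is $c>0$ with $L(g)\ge c$ for all $g\notin G^{(0)}$. A map $L:G\to[0,\infty)$ is proper if every $K\subseteq G\setminus G^{(0)}$ on which $L$ is bounded has compact closure, and controlled if $L$ is bounded on every $K\subseteq G$ with compact closure. For $l:S\to[0,\infty)$ and $L:G\to[0,\infty)$ put $$\Phi(l)([s,\xi])=\inf\{l(t):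 t\in S,\ \xi\in D_{t^*t},\ [t,\xi]=[s,\xi]\},\qquad \Psi(L)(s)=\sup_{\xi\in D_{s^*s}}L([s,\xi]).$$ Then the following hold. - If $l$ is a uniformly discrete length function on $S$, then $\Phi(l)$ is a uniformly discrete length function on $G$. For every length function $l$ on $S$, $\Phi(l)$ is controlled. The map $\Phi$ is injective on the set of length functions on $S$. - If $L:G\to[0,\infty)$ is controlled, then the suprema defining $\Psi(L)$ are finite. If $L$ is a controlled length function on $G$, then $\Psi(L)$ is a length function on $S$, and it is uniformly discrete if $L$ is. For every length function $l$ on $S$ one has $\Psi(\Phi(l))=l$. - A length function $l$ on $S$ is proper if and only if $\Phi(l)$ is proper. - If a length function $l$ on $S$ is tightly proper, then $\Phi(l)$ is proper and continuous. Conversely, if $l$ is a length function on $S$ whose set of values is a closed discrete subset of $[0,\infty)$ (that is, $l$ takes only finitely many values in each bounded interval), and $\Phi(l)$ is proper and continuous, then $l$ is tightly proper. -/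

import Mathlib

open scoped NNReal

/-- An inverse semigroup: every `s` has exactly one `s⁻¹` (written `s^*` in operator algebras)
with `s s⁻¹ s = s` and `s⁻¹ s s⁻¹ = s⁻¹`. -/
class InverseSemigroup (S : Type*) extends Semigroup S, Inv S where
  mul_inv_mul : ∀ s : S, s * s⁻¹ * s = s
  inv_mul_inv : ∀ s : S, s⁻¹ * s * s⁻¹ = s⁻¹
  inv_unique : ∀ s t : S, s * t * s = s → t * s * t = t → t = s⁻¹

namespace InverseSemigroup

variable {S : Type*} [InverseSemigroup S]

/-! ### Basic algebra -/

theorem inv_idem {e : S} (he : IsIdempotentElem e) : e⁻¹ = e := by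
  have h : e * e = e := he
  exact (inv_unique e e (by rw [h, h]) (by rw [h, h])).symm

theorem inv_inv' (s : S) : s⁻¹⁻¹ = s :=
  (inv_unique s⁻¹ s (inv_mul_inv s) (mul_inv_mul s)).symm

theorem idem_inv_mul (s : S) : IsIdempotentElem (s⁻¹ * s) := by
  change s⁻¹ * s * (s⁻¹ * s) = s⁻¹ * s
  rw [← mul_assoc, inv_mul_inv]

theorem idem_mul_inv (s : S) : IsIdempotentElem (s * s⁻¹) := by
  change s * s⁻¹ * (s * s⁻¹) = s * s⁻¹
  rw [← mul_assoc, mul_inv_mul]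

theorem idem_mul {e f : S} (he : IsIdempotentElem e) (hf : IsIdempotentElem f) :
    IsIdempotentElem (e * f) := by
  have he' : ∀ a, e * (e * a) = e * a := fun a => by rw [← mul_assoc, he.eq]
  have hf' : ∀ a, f * (f * a) = f * a := fun a => by rw [← mul_assoc, hf.eq]
  have h1 : ∀ a, e * (f * ((e * f)⁻¹ * (e * (f * a)))) = e * (f * a) := fun a => by
    have := congrArg (· * a) (mul_inv_mul (e * f))
    simpa only [mul_assoc] using this
  have h1' : e * (f * ((e * f)⁻¹ * (e * f))) = e * f := by
    simpa only [mul_assoc] using mul_inv_mul (e * f)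
  have h2 : ∀ a, (e * f)⁻¹ * (e * (f * ((e * f)⁻¹ * a))) = (e * f)⁻¹ * a := fun a => by
    have := congrArg (· * a) (inv_mul_inv (e * f))
    simpa only [mul_assoc] using this
  have hx : f * (e * f)⁻¹ * e = (e * f)⁻¹ := by
    apply inv_unique
    · simp only [mul_assoc, he', hf', h1']
    · simp only [mul_assoc, he', hf', h2]
  have hxi : IsIdempotentElem (e * f)⁻¹ := by
    change (e * f)⁻¹ * (e * f)⁻¹ = (e * f)⁻¹
    conv_lhs => rw [← hx]
    conv_rhs => rw [← hx]
    simp only [mul_assoc, h2]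
  have : e * f = (e * f)⁻¹ := by
    conv_lhs => rw [← inv_inv' (e * f)]
    exact inv_idem hxi
  rw [this]; exact hxi

theorem idem_comm {e f : S} (he : IsIdempotentElem e) (hf : IsIdempotentElem f) :
    e * f = f * e := by
  have he' : ∀ a, e * (e * a) = e * a := fun a => by rw [← mul_assoc, he.eq]
  have hf' : ∀ a, f * (f * a) = f * a := fun a => by rw [← mul_assoc, hf.eq]
  have h1 : e * (f * (e * f)) = e * f := by
    simpa only [mul_assoc] using (idem_mul he hf).eq
  have h2 : f * (e * (f * e)) = f * e := by
    simpa only [mul_assoc] using (idem_mul hf he).eq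
  have : f * e = (e * f)⁻¹ := by
    apply inv_unique
    · simp only [mul_assoc, he', hf', h1]
    · simp only [mul_assoc, he', hf', h2]
  rw [this, inv_idem (idem_mul he hf)]

theorem mul_inv_rev' (s t : S) : (s * t)⁻¹ = t⁻¹ * s⁻¹ := by
  have hc := idem_comm (idem_inv_mul s) (idem_mul_inv t)
  symm
  apply inv_unique
  · calc s * t * (t⁻¹ * s⁻¹) * (s * t) = s * ((t * t⁻¹) * (s⁻¹ * s)) * t := by
          simp only [mul_assoc]
      _ = (s * s⁻¹ * s) * (t * t⁻¹ * t) := by rw [← hc]; simp only [mul_assoc]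
      _ = s * t := by rw [mul_inv_mul, mul_inv_mul]
  · calc t⁻¹ * s⁻¹ * (s * t) * (t⁻¹ * s⁻¹) = t⁻¹ * ((s⁻¹ * s) * (t * t⁻¹)) * s⁻¹ := by
          simp only [mul_assoc]
      _ = (t⁻¹ * t * t⁻¹) * (s⁻¹ * s * s⁻¹) := by rw [hc]; simp only [mul_assoc]
      _ = t⁻¹ * s⁻¹ := by rw [inv_mul_inv, inv_mul_inv]

theorem conj_mul_conj (s : S) {f g : S} (hf : IsIdempotentElem f) :
    (s * f * s⁻¹) * (s * g * s⁻¹) = s * (f * g) * s⁻¹ := by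
  calc (s * f * s⁻¹) * (s * g * s⁻¹) = s * (f * (s⁻¹ * s)) * (g * s⁻¹) := by
        simp only [mul_assoc]
    _ = (s * s⁻¹ * s) * (f * g) * s⁻¹ := by
        rw [idem_comm hf (idem_inv_mul s)]; simp only [mul_assoc]
    _ = s * (f * g) * s⁻¹ := by rw [mul_inv_mul]

theorem idem_conj (s : S) {f : S} (hf : IsIdempotentElem f) :
    IsIdempotentElem (s * f * s⁻¹) := by
  change (s * f * s⁻¹) * (s * f * s⁻¹) = s * f * s⁻¹
  rw [conj_mul_conj s hf, hf.eq]

/-- The natural partial order: `s ≤ t` iff `s s⁻¹ t = s`. On idempotents it says `e f = e`. -/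
def NatLE (s t : S) : Prop := s * s⁻¹ * t = s

variable (S) in
/-- `S` is quasi-countable: some countable `X` generates `S`, as an inverse semigroup, together
with the idempotents, i.e. every inverse subsemigroup containing `X` and the idempotents is `S`. -/
def QuasiCountable : Prop :=
  ∃ X : Set S, X.Countable ∧
    ∀ T : Set S, X ⊆ T → (∀ e : S, IsIdempotentElem e → e ∈ T) →
      (∀ s ∈ T, ∀ t ∈ T, s * t ∈ T) → (∀ s ∈ T, s⁻¹ ∈ T) → T = Set.univ

/-! ### The spectrum of the semilattice of idempotents -/

variable (S) in
/-- A (nonempty) filter on the semilattice `E` of idempotents of `S`; the type of all of them is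
the spectrum `Ê₀` of `E`. -/
@[ext]
structure IdemFilter where
  carrier : Set S
  idem : ∀ e ∈ carrier, IsIdempotentElem e
  nonempty : carrier.Nonempty
  mul_mem : ∀ e ∈ carrier, ∀ f ∈ carrier, e * f ∈ carrier
  up : ∀ e ∈ carrier, ∀ f, IsIdempotentElem f → e * f = e → f ∈ carrier

instance : Membership S (IdemFilter S) := ⟨fun ξ e => e ∈ ξ.carrier⟩

/-- The topology on the spectrum with basis `D_e ∩ D_{e₁}ᶜ ∩ ⋯ ∩ D_{eₙ}ᶜ`, where
`e₁, …, eₙ < e` and `D_e = {ξ | e ∈ ξ}`. -/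
instance : TopologicalSpace (IdemFilter S) :=
  TopologicalSpace.generateFrom
    {U | ∃ (e : S) (F : Finset S), IsIdempotentElem e ∧
      (∀ f ∈ F, IsIdempotentElem f ∧ f * e = f ∧ f ≠ e) ∧
      U = {ξ | e ∈ ξ ∧ ∀ f ∈ F, f ∉ ξ}}

/-- `θ_s(ξ) = {e ∈ E | e ≥ s f s⁻¹ for some f ∈ ξ}`; restricted to the `ξ` with
`s⁻¹ s ∈ ξ` it is the partial homeomorphism `D_{s⁻¹s} → D_{ss⁻¹}`. -/
def theta (s : S) (ξ : IdemFilter S) : IdemFilter S where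
  carrier := {e | IsIdempotentElem e ∧ ∃ f ∈ ξ, (s * f * s⁻¹) * e = s * f * s⁻¹}
  idem := fun _ he => he.1
  nonempty := by
    obtain ⟨f, hf⟩ := ξ.nonempty
    exact ⟨s * f * s⁻¹, idem_conj s (ξ.idem f hf), f, hf, (idem_conj s (ξ.idem f hf)).eq⟩
  mul_mem := by
    rintro a ⟨ha, f, hf, hfa⟩ b ⟨hb, g, hg, hgb⟩
    have hfi := ξ.idem f hf
    have hgi := ξ.idem g hg
    refine ⟨idem_mul ha hb, f * g, ξ.mul_mem f hf g hg, ?_⟩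
    rw [← conj_mul_conj s hfi]
    calc s * f * s⁻¹ * (s * g * s⁻¹) * (a * b)
        = s * f * s⁻¹ * ((s * g * s⁻¹) * a) * b := by simp only [mul_assoc]
      _ = (s * f * s⁻¹ * a) * ((s * g * s⁻¹) * b) := by
          rw [idem_comm (idem_conj s hgi) ha]; simp only [mul_assoc]
      _ = s * f * s⁻¹ * (s * g * s⁻¹) := by rw [hfa, hgb]
  up := by
    rintro a ⟨_, f, hf, hfa⟩ b hb hab
    exact ⟨hb, f, hf, by rw [← hfa, mul_assoc, hab]⟩

theorem conj_mem_theta (s : S) {ξ : IdemFilter S} {f : S} (hf : f ∈ ξ) :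
    s * f * s⁻¹ ∈ theta s ξ :=
  ⟨idem_conj s (ξ.idem f hf), f, hf, (idem_conj s (ξ.idem f hf)).eq⟩

theorem mul_inv_mem_theta {s : S} {ξ : IdemFilter S} (h : s⁻¹ * s ∈ ξ) :
    s⁻¹⁻¹ * s⁻¹ ∈ theta s ξ := by
  rw [inv_inv']
  have := conj_mem_theta s h
  rwa [← mul_assoc, mul_inv_mul] at this

theorem theta_subset {s t e : S} {ξ : IdemFilter S} (he : e ∈ ξ) (h : s * e = t * e) :
    ∀ a ∈ theta s ξ, a ∈ theta t ξ := by
  rintro a ⟨ha, f, hf, hfa⟩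
  have hei := ξ.idem e he
  have hfi := ξ.idem f hf
  have key : s * (e * f) * s⁻¹ = t * (e * f) * t⁻¹ := by
    have hh : e * f = e * f * e := by
      rw [mul_assoc, idem_comm hfi hei, ← mul_assoc, hei.eq]
    have h2 : e * s⁻¹ = e * t⁻¹ := by
      have := congrArg (·⁻¹) h
      simpa only [mul_inv_rev', inv_idem hei] using this
    rw [hh]
    calc s * (e * f * e) * s⁻¹ = (s * e) * f * (e * s⁻¹) := by simp only [mul_assoc]
      _ = t * (e * f * e) * t⁻¹ := by rw [h, h2]; simp only [mul_assoc]
  refine ⟨ha, e * f, ξ.mul_mem e he f hf, ?_⟩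
  rw [← key, ← conj_mul_conj s hei, mul_assoc, hfa]

theorem theta_congr {s t e : S} {ξ : IdemFilter S} (he : e ∈ ξ) (h : s * e = t * e) :
    theta s ξ = theta t ξ := by
  ext a
  exact ⟨theta_subset he h a, theta_subset he h.symm a⟩

/-! ### The universal groupoid -/

variable (S) in
/-- Pairs `(s, ξ)` with `ξ ∈ D_{s⁻¹s}`. -/
structure PreGerm where
  elt : S
  pt : IdemFilter S
  mem : elt⁻¹ * elt ∈ pt

variable (S) in
/-- `(s, ξ) ∼ (t, ζ)` iff `ξ = ζ` and `s e = t e` for some idempotent `e ∈ ξ`. -/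
instance germSetoid : Setoid (PreGerm S) where
  r p q := p.pt = q.pt ∧ ∃ e ∈ p.pt, p.elt * e = q.elt * e
  iseqv :=
    { refl := fun p => ⟨rfl, _, p.mem, rfl⟩
      symm := by
        rintro p q ⟨h, e, he, h'⟩
        exact ⟨h.symm, e, h ▸ he, h'.symm⟩
      trans := by
        rintro p q r ⟨h, e, he, h'⟩ ⟨k, f, hf, k'⟩
        have hf' : f ∈ p.pt := h ▸ hf
        refine ⟨h.trans k, e * f, p.pt.mul_mem e he f hf', ?_⟩
        calc p.elt * (e * f) = q.elt * (e * f) := by rw [← mul_assoc, h', mul_assoc]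
          _ = q.elt * f * e := by
              rw [idem_comm (p.pt.idem e he) (p.pt.idem f hf'), mul_assoc]
          _ = r.elt * (e * f) := by
              rw [k', idem_comm (p.pt.idem e he) (p.pt.idem f hf'), mul_assoc] }

variable (S) in
/-- The universal groupoid of `S`: the groupoid of germs of the action `θ` on the spectrum. -/
def UnivGroupoid : Type _ := Quotient (germSetoid S)

/-- The germ `[s, ξ]`, for `ξ ∈ D_{s⁻¹s}`. -/
def germ (s : S) (ξ : IdemFilter S) (h : s⁻¹ * s ∈ ξ) : UnivGroupoid S :=
  Quotient.mk (germSetoid S) ⟨s, ξ, h⟩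

/-- The topology of germs, with basis the sets `{[s, ξ] | ξ ∈ U}` for `s ∈ S` and `U ⊆ D_{s⁻¹s}`
open in the spectrum. -/
instance : TopologicalSpace (UnivGroupoid S) :=
  TopologicalSpace.generateFrom
    {V | ∃ (s : S) (U : Set (IdemFilter S)) (hU : ∀ ξ ∈ U, s⁻¹ * s ∈ ξ), IsOpen U ∧
      V = {g | ∃ (ξ : IdemFilter S) (h : ξ ∈ U), g = germ s ξ (hU ξ h)}}

namespace UnivGroupoid

/-- The unit space `G⁽⁰⁾`: the germs of idempotents. -/
def units : Set (UnivGroupoid S) :=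
  {g | ∃ (e : S) (ξ : IdemFilter S) (h : e⁻¹ * e ∈ ξ), IsIdempotentElem e ∧ g = germ e ξ h}

/-- The source `s([s, ξ]) = ξ`. -/
def source (g : UnivGroupoid S) : IdemFilter S :=
  Quotient.lift (fun p : PreGerm S => p.pt) (by rintro p q ⟨h, -⟩; exact h) g

/-- The range `r([s, ξ]) = θ_s(ξ)`. -/
def range (g : UnivGroupoid S) : IdemFilter S :=
  Quotient.lift (fun p : PreGerm S => theta p.elt p.pt)
    (by
      rintro p q ⟨h, e, he, h'⟩
      rw [← h]
      exact theta_congr he h') g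

/-- The inverse `[s, ξ]⁻¹ = [s⁻¹, θ_s(ξ)]`. -/
instance : Inv (UnivGroupoid S) where
  inv := Quotient.lift
    (fun p : PreGerm S => germ p.elt⁻¹ (theta p.elt p.pt) (mul_inv_mem_theta p.mem))
    (by
      rintro p q ⟨h, e, he, h'⟩
      have hei := p.pt.idem e he
      refine Quotient.sound (s := germSetoid S)
        ⟨?_, p.elt * e * p.elt⁻¹, conj_mem_theta _ he, ?_⟩
      · change theta p.elt p.pt = theta q.elt q.pt
        rw [← h]
        exact theta_congr he h'
      · change p.elt⁻¹ * (p.elt * e * p.elt⁻¹) = q.elt⁻¹ * (p.elt * e * p.elt⁻¹)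
        have h2 : e * p.elt⁻¹ = e * q.elt⁻¹ := by
          have := congrArg (·⁻¹) h'
          simpa only [mul_inv_rev', inv_idem hei] using this
        have h3 : ∀ s : S, s⁻¹ * (s * e * s⁻¹) = e * s⁻¹ := fun s => by
          calc s⁻¹ * (s * e * s⁻¹) = (s⁻¹ * s) * e * s⁻¹ := by simp only [mul_assoc]
            _ = e * (s⁻¹ * s * s⁻¹) := by
                rw [idem_comm (idem_inv_mul s) hei]; simp only [mul_assoc]
            _ = e * s⁻¹ := by rw [inv_mul_inv]
        have h4 : p.elt * e * p.elt⁻¹ = q.elt * e * q.elt⁻¹ := by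
          rw [mul_assoc, h2, ← mul_assoc, h']
        rw [h3, h4, h3, h2])

theorem mul_aux {s t : S} {ξ : IdemFilter S} (ht : t⁻¹ * t ∈ ξ)
    (hs : s⁻¹ * s ∈ theta t ξ) : (s * t)⁻¹ * (s * t) ∈ ξ := by
  obtain ⟨-, f, hf, h⟩ := hs
  have hfi := ξ.idem f hf
  refine ξ.up _ (ξ.mul_mem _ ht f hf) _ (idem_inv_mul _) ?_
  rw [mul_inv_rev']
  calc t⁻¹ * t * f * (t⁻¹ * s⁻¹ * (s * t))
      = t⁻¹ * ((t * f * t⁻¹) * (s⁻¹ * s)) * t := by simp only [mul_assoc]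
    _ = t⁻¹ * t * (f * (t⁻¹ * t)) := by rw [h]; simp only [mul_assoc]
    _ = t⁻¹ * t * f := by
        rw [idem_comm hfi (idem_inv_mul t), ← mul_assoc, (idem_inv_mul t).eq]

open Classical in
/-- The product of composable arrows (those with `s(g) = r(h)`):
`[s, θ_t(ξ)] [t, ξ] = [s t, ξ]`. It has the meaningless value `h` on the other pairs. -/
noncomputable instance : Mul (UnivGroupoid S) where
  mul := Quotient.lift₂
    (fun p q : PreGerm S =>
      if hc : p.pt = theta q.elt q.pt then
        germ (p.elt * q.elt) q.pt (mul_aux q.mem (hc ▸ p.mem))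
      else germ q.elt q.pt q.mem)
    (by
      rintro p q p' q' ⟨hp, e, he, hpe⟩ ⟨hq, f, hf, hqf⟩
      have hth : theta q.elt q.pt = theta q'.elt q'.pt := by
        rw [← hq]; exact theta_congr hf hqf
      by_cases hc : p.pt = theta q.elt q.pt
      · have hc' : p'.pt = theta q'.elt q'.pt := by rw [← hp, hc, hth]
        refine (dif_pos hc).trans (Eq.trans ?_ (dif_pos hc').symm)
        rw [hc] at he
        obtain ⟨hei, g, hg, hge⟩ := he
        have hgi := q.pt.idem g hg
        have hfi := q.pt.idem f hf
        refine Quotient.sound (s := germSetoid S) ⟨hq, g * f, q.pt.mul_mem g hg f hf, ?_⟩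
        change p.elt * q.elt * (g * f) = p'.elt * q'.elt * (g * f)
        generalize p.elt = s at *
        generalize p'.elt = s' at *
        generalize q.elt = t at *
        generalize q'.elt = t' at *
        have htg : t * g = t * g * t⁻¹ * t := by
          calc t * g = (t * t⁻¹ * t) * g := by rw [mul_inv_mul]
            _ = t * ((t⁻¹ * t) * g) := by simp only [mul_assoc]
            _ = t * g * t⁻¹ * t := by
                rw [idem_comm (idem_inv_mul t) hgi]; simp only [mul_assoc]
        have k : e * (t * g) = t * g := by
          rw [htg, ← mul_assoc, idem_comm hei (idem_conj t hgi), hge]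
        calc s * t * (g * f) = s * (t * g) * f := by simp only [mul_assoc]
          _ = s * e * (t * g) * f := by rw [← k]; simp only [mul_assoc, ← mul_assoc e e, hei.eq]
          _ = s' * (e * (t * g)) * f := by rw [hpe]; simp only [mul_assoc]
          _ = s' * (t * (g * f)) := by rw [k]; simp only [mul_assoc]
          _ = s' * (t * f * g) := by rw [idem_comm hgi hfi, mul_assoc]
          _ = s' * t' * (g * f) := by rw [hqf, idem_comm hgi hfi]; simp only [mul_assoc]
      · have hc' : ¬ p'.pt = theta q'.elt q'.pt := by rw [← hp, ← hth]; exact hc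
        refine (dif_neg hc).trans (Eq.trans ?_ (dif_neg hc').symm)
        exact Quotient.sound (s := germSetoid S) ⟨hq, f, hf, hqf⟩)

theorem germ_mul_germ (s t : S) (ξ : IdemFilter S) (ht : t⁻¹ * t ∈ ξ)
    (hs : s⁻¹ * s ∈ theta t ξ) :
    germ s (theta t ξ) hs * germ t ξ ht = germ (s * t) ξ (mul_aux ht hs) :=
  dif_pos rfl

/-- A length function on the groupoid. -/
structure IsLength (L : UnivGroupoid S → ℝ≥0) : Prop where
  eq_zero_iff : ∀ g, L g = 0 ↔ g ∈ units
  inv : ∀ g, L g⁻¹ = L g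
  mul_le : ∀ g h, g.source = h.range → L (g * h) ≤ L g + L h

/-- Sets of non-units on which `L` is bounded are precompact. -/
def Proper (L : UnivGroupoid S → ℝ≥0) : Prop :=
  ∀ K : Set (UnivGroupoid S), K ⊆ unitsᶜ → BddAbove (L '' K) → IsCompact (closure K)

/-- `L` is bounded on precompact sets. -/
def Controlled (L : UnivGroupoid S → ℝ≥0) : Prop :=
  ∀ K : Set (UnivGroupoid S), IsCompact (closure K) → BddAbove (L '' K)

/-- The values of `L` on non-units are bounded away from `0`. -/
def UniformlyDiscrete (L : UnivGroupoid S → ℝ≥0) : Prop :=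
  ∃ c > 0, ∀ g, g ∉ units → c ≤ L g

end UnivGroupoid

/-! ### Length functions on the inverse semigroup -/

/-- A length function on the inverse semigroup. -/
structure IsLength (l : S → ℝ≥0) : Prop where
  eq_zero_iff : ∀ s, l s = 0 ↔ IsIdempotentElem s
  inv : ∀ s, l s⁻¹ = l s
  mul_le : ∀ s t, l (s * t) ≤ l s + l t

/-- The values of `l` on non-idempotents are bounded away from `0`; equivalently, the extended
metric `d(s, t) = l(t s⁻¹)` (if `s⁻¹s = t⁻¹t`; `∞` otherwise) is uniformly discrete. -/
def UniformlyDiscrete (l : S → ℝ≥0) : Prop :=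
  ∃ c > 0, ∀ s, ¬ IsIdempotentElem s → c ≤ l s

/-- The values of `l` form a closed discrete subset of `[0, ∞)`. -/
def DiscreteValues (l : S → ℝ≥0) : Prop :=
  ∀ r : ℝ≥0, (Set.range l ∩ Set.Iic r).Finite

/-- The finite set `F` witnesses `r`-properness of `l`: each element of the cylinder
`{s | 0 < l(s) ≤ r}` lies below an element of `F`. -/
def Witnesses (l : S → ℝ≥0) (r : ℝ≥0) (F : Finset S) : Prop :=
  ∀ s, 0 < l s → l s ≤ r → ∃ m ∈ F, NatLE s m

/-- `l` is proper. -/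
def Proper (l : S → ℝ≥0) : Prop :=
  ∀ r : ℝ≥0, ∃ F : Finset S, Witnesses l r F

/-- `l` is tightly proper. -/
def TightlyProper (l : S → ℝ≥0) : Prop :=
  ∀ r : ℝ≥0, ∃ F : Finset S, Witnesses l r F ∧ ∀ m ∈ F, l m ≤ r

/-! ### The maps between the two kinds of length functions -/

/-- `Φ(l)([s, ξ]) = inf {l(t) | t ∈ S, ξ ∈ D_{t⁻¹t}, [t, ξ] = [s, ξ]}`. -/
noncomputable def Phi (l : S → ℝ≥0) (g : UnivGroupoid S) : ℝ≥0 :=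
  sInf {r | ∃ (t : S) (h : t⁻¹ * t ∈ g.source), germ t g.source h = g ∧ r = l t}

/-- `Ψ(L)(s) = sup_{ξ ∈ D_{s⁻¹s}} L([s, ξ])`. -/
noncomputable def Psi (L : UnivGroupoid S → ℝ≥0) (s : S) : ℝ≥0 :=
  ⨆ ξ : {ξ : IdemFilter S // s⁻¹ * s ∈ ξ}, L (germ s ξ.1 ξ.2)

end InverseSemigroup

namespace InverseSemigroup

open Set Topology

variable {S : Type*} [InverseSemigroup S]

/-! ### Algebra of the natural order -/

/-! Two facts carry everything. First, the germ of `s` at the principal filter of `s⁻¹ * s`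
remembers `s` up to the natural order: if it is also a germ of `m`, then `s ≤ m`
(`natLE_of_principalGerm_eq`). A length function is monotone for this order, so `Phi l` takes the
value `l s` at that germ (`IsLength.Phi_principalGerm`). Hence `Psi (Phi l) = l`, and `Phi` is
injective.

Second, the bisections are compact, open and cover the groupoid. Compact sets therefore lie in
finitely many of them (`exists_finset_bisection_cover`), and `Phi l ≤ l t` on the bisection of `t`.
This gives control of `Phi l`, and it turns a finite witness set for `l` into a finite cover of a
set of non-units of bounded length, and back.

For continuity, `Phi l` is always upper semicontinuous, being an infimum over local representatives.
Tight properness writes its sublevel sets in terms of bisections and the unit space, which are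
closed because the groupoid is Hausdorff. Conversely, discreteness of the values makes the infimum
attained, so compact sublevel sets off the units can be covered by bisections of elements of length
at most `r`. -/

theorem inv_mul_self_of_idem {e : S} (he : IsIdempotentElem e) : e⁻¹ * e = e := by
  rw [inv_idem he, he.eq]

/-- Passes from restriction on the range side, as in the definition of the order, to restriction on
the source side, which is the form that germs see. It rests on the commutation of `m * m⁻¹` with `s
* s⁻¹`. -/
theorem NatLE.mul_inv_mul_eq {s m : S} (h : NatLE s m) : m * (s⁻¹ * s) = s := by
  have hs : s * s⁻¹ * m = s := h
  calc m * (s⁻¹ * s) = m * ((s * s⁻¹ * m)⁻¹ * (s * s⁻¹ * m)) := by rw [hs]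
    _ = m * m⁻¹ * (s * s⁻¹) * (s * s⁻¹) * m := by
        rw [mul_inv_rev', inv_idem (idem_mul_inv s)]; simp only [mul_assoc]
    _ = (s * s⁻¹) * (m * m⁻¹) * m := by
        rw [mul_assoc (m * m⁻¹), (idem_mul_inv s).eq,
          idem_comm (idem_mul_inv m) (idem_mul_inv s)]
    _ = s := by rw [mul_assoc, mul_inv_mul, hs]

theorem natLE_of_mul_idem {s m f : S} (hf : IsIdempotentElem f) (h : m * f = s) :
    NatLE s m := by
  subst h
  change m * f * (m * f)⁻¹ * m = m * f
  calc m * f * (m * f)⁻¹ * m = m * (f * f * (m⁻¹ * m)) := by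
        rw [mul_inv_rev', inv_idem hf]; simp only [mul_assoc]
    _ = m * ((m⁻¹ * m) * f) := by rw [hf.eq, idem_comm hf (idem_inv_mul m)]
    _ = m * f := by rw [← mul_assoc, ← mul_assoc, mul_inv_mul]

theorem NatLE.inv_mul_mul_inv_mul {s m : S} (h : NatLE s m) :
    (s⁻¹ * s) * (m⁻¹ * m) = s⁻¹ * s := by
  rw [idem_comm (idem_inv_mul s) (idem_inv_mul m), mul_assoc, h.mul_inv_mul_eq]
  conv_lhs => rw [← h.mul_inv_mul_eq]
  conv_rhs => rw [← h.mul_inv_mul_eq]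
  rw [mul_inv_rev', inv_idem (idem_inv_mul s)]
  have := idem_comm (idem_inv_mul m) (idem_inv_mul s)
  calc m⁻¹ * (m * (s⁻¹ * s)) = (m⁻¹ * m) * ((s⁻¹ * s) * (s⁻¹ * s)) := by
        rw [(idem_inv_mul s).eq, mul_assoc m⁻¹]
    _ = (m⁻¹ * m) * (s⁻¹ * s) * (s⁻¹ * s) := by simp only [mul_assoc]
    _ = s⁻¹ * s * m⁻¹ * (m * (s⁻¹ * s)) := by rw [this]; simp only [mul_assoc]

/-! ### Filters -/

/-- The principal filter of all idempotents above `e`. -/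
def principal (e : S) (he : IsIdempotentElem e) : IdemFilter S where
  carrier := {f | IsIdempotentElem f ∧ e * f = e}
  idem := fun _ hf => hf.1
  nonempty := ⟨e, he, he⟩
  mul_mem := by
    rintro f ⟨hf, hef⟩ g ⟨hg, heg⟩
    exact ⟨idem_mul hf hg, by rw [← mul_assoc, hef, heg]⟩
  up := by
    rintro f ⟨-, hef⟩ g hg hfg
    exact ⟨hg, by rw [← hef, mul_assoc, hfg]⟩

theorem self_mem_principal {e : S} (he : IsIdempotentElem e) : e ∈ principal e he := ⟨he, he⟩

theorem theta_inv_theta {s : S} {ξ : IdemFilter S} (h : s⁻¹ * s ∈ ξ) :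
    theta s⁻¹ (theta s ξ) = ξ := by
  ext a
  constructor
  · rintro ⟨ha, b, ⟨hb, f, hf, hfb⟩, hba⟩
    rw [inv_inv'] at hba
    have hfi := ξ.idem f hf
    have key : s⁻¹ * (s * f * s⁻¹) * s = s⁻¹ * s * f := by
      calc s⁻¹ * (s * f * s⁻¹) * s = (s⁻¹ * s) * (f * (s⁻¹ * s)) := by simp only [mul_assoc]
        _ = s⁻¹ * s * f := by
          rw [idem_comm hfi (idem_inv_mul s), ← mul_assoc, (idem_inv_mul s).eq]
    refine ξ.up _ (ξ.mul_mem _ h f hf) a ha ?_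
    have hconj : s⁻¹ * (s * f * s⁻¹) * s = (s⁻¹ * (s * f * s⁻¹) * s) * (s⁻¹ * b * s) := by
      have := conj_mul_conj s⁻¹ (g := b) (idem_conj s hfi)
      rw [inv_inv', hfb] at this
      exact this.symm
    rw [← key, hconj, mul_assoc, hba]
  · intro ha
    have hai := ξ.idem a ha
    refine ⟨hai, s * a * s⁻¹, conj_mem_theta s ha, ?_⟩
    rw [inv_inv']
    calc s⁻¹ * (s * a * s⁻¹) * s * a = (s⁻¹ * s) * a * ((s⁻¹ * s) * a) := by
          simp only [mul_assoc]
      _ = (s⁻¹ * s) * a * (a * (s⁻¹ * s)) := by rw [idem_comm hai (idem_inv_mul s)]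
      _ = (s⁻¹ * s) * (a * a) * (s⁻¹ * s) := by simp only [mul_assoc]
      _ = s⁻¹ * (s * a * s⁻¹) * s := by rw [hai.eq]; simp only [mul_assoc]

/-- With `mem_theta_of_mul_mem`, a converse to `mul_aux`: every germ of `s * t` factors as a germ of
`s` times a germ of `t`. This is what subadditivity of `Psi L` needs. -/
theorem mem_of_mul_mem {s t : S} {ξ : IdemFilter S} (h : (s * t)⁻¹ * (s * t) ∈ ξ) :
    t⁻¹ * t ∈ ξ := by
  refine ξ.up _ h _ (idem_inv_mul t) ?_
  rw [mul_inv_rev']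
  simp only [mul_assoc]
  rw [← mul_assoc t, mul_inv_mul]

theorem mem_theta_of_mul_mem {s t : S} {ξ : IdemFilter S} (h : (s * t)⁻¹ * (s * t) ∈ ξ) :
    s⁻¹ * s ∈ theta t ξ := by
  refine ⟨idem_inv_mul s, _, h, ?_⟩
  rw [mul_inv_rev']
  calc t * (t⁻¹ * s⁻¹ * (s * t)) * t⁻¹ * (s⁻¹ * s)
      = (t * t⁻¹) * (s⁻¹ * s) * ((t * t⁻¹) * (s⁻¹ * s)) := by simp only [mul_assoc]
    _ = (t * t⁻¹) * (s⁻¹ * s) * ((s⁻¹ * s) * (t * t⁻¹)) := by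
        rw [idem_comm (idem_mul_inv t) (idem_inv_mul s)]
    _ = (t * t⁻¹) * ((s⁻¹ * s) * (s⁻¹ * s)) * (t * t⁻¹) := by simp only [mul_assoc]
    _ = t * (t⁻¹ * s⁻¹ * (s * t)) * t⁻¹ := by
        rw [(idem_inv_mul s).eq]; simp only [mul_assoc]

theorem isOpen_setOf_mem (e : S) : IsOpen {ξ : IdemFilter S | e ∈ ξ} := by
  by_cases he : IsIdempotentElem e
  · exact TopologicalSpace.isOpen_generateFrom_of_mem ⟨e, ∅, he, by simp, by simp⟩
  · convert isOpen_empty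
    exact eq_empty_of_forall_notMem fun ξ h => he (ξ.idem e h)

/-- The idempotents that lie in almost every filter along an ultrafilter form a filter again; it
contains `e`, and the ultrafilter converges to it. -/
theorem isCompact_setOf_mem (e : S) : IsCompact {ξ : IdemFilter S | e ∈ ξ} := by
  rw [isCompact_iff_ultrafilter_le_nhds]
  intro U hU
  have hUe : ∀ᶠ ξ in (U : Filter (IdemFilter S)), e ∈ ξ := Filter.le_principal_iff.1 hU
  let ξ₀ : IdemFilter S :=
    { carrier := {a | ∀ᶠ ξ in (U : Filter (IdemFilter S)), a ∈ ξ}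
      idem := fun a ha => by
        obtain ⟨ξ, hξ⟩ := Filter.Eventually.exists ha
        exact ξ.idem a hξ
      nonempty := ⟨e, hUe⟩
      mul_mem := fun a ha b hb =>
        (Filter.Eventually.and ha hb).mono fun ξ h => ξ.mul_mem a h.1 b h.2
      up := fun a ha b hb hab => Filter.Eventually.mono ha fun ξ h => ξ.up a h b hb hab }
  refine ⟨ξ₀, hUe, ?_⟩
  rw [TopologicalSpace.nhds_generateFrom]
  refine le_iInf₂ fun V hV => ?_
  obtain ⟨hξ, a, F, -, -, rfl⟩ := hV
  rw [Filter.le_principal_iff]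
  -- Along an ultrafilter, failing to hold eventually means that the negation holds eventually;
  -- finiteness of `F` allows the intersection.
  have hF : ∀ᶠ ξ in (U : Filter (IdemFilter S)), ∀ f ∈ F, f ∉ ξ :=
    (Filter.eventually_all_finset F).2 fun f hf => Ultrafilter.eventually_not.2 (hξ.2 f hf)
  exact Filter.Eventually.and hξ.1 hF

/-! ### Germs -/

theorem germ_eq_iff {s t : S} {ξ : IdemFilter S} (hs : s⁻¹ * s ∈ ξ) (ht : t⁻¹ * t ∈ ξ) :
    germ s ξ hs = germ t ξ ht ↔ ∃ e ∈ ξ, s * e = t * e :=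
  ⟨fun h => (Quotient.exact (s := germSetoid S) h).2,
    fun h => Quotient.sound (s := germSetoid S) ⟨rfl, h⟩⟩

theorem germ_congr {s t : S} {ξ ζ : IdemFilter S} (hs : s⁻¹ * s ∈ ξ) (hst : s = t)
    (hξ : ξ = ζ) : germ s ξ hs = germ t ζ (hst ▸ hξ ▸ hs) := by
  subst hst hξ; rfl

theorem exists_eq_germ (g : UnivGroupoid S) : ∃ s ξ h, g = germ s ξ h := by
  induction g using Quotient.inductionOn with
  | h p => exact ⟨p.elt, p.pt, p.mem, rfl⟩

theorem inv_germ (s : S) (ξ : IdemFilter S) (h : s⁻¹ * s ∈ ξ) :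
    (germ s ξ h)⁻¹ = germ s⁻¹ (theta s ξ) (mul_inv_mem_theta h) := rfl

theorem UnivGroupoid.inv_inv (g : UnivGroupoid S) : g⁻¹⁻¹ = g := by
  obtain ⟨s, ξ, h, rfl⟩ := exists_eq_germ g
  rw [inv_germ, inv_germ]
  exact germ_congr _ (inv_inv' s) (theta_inv_theta h)

theorem NatLE.inv_mul_mem {s m : S} (h : NatLE s m) {ξ : IdemFilter S} (hs : s⁻¹ * s ∈ ξ) :
    m⁻¹ * m ∈ ξ :=
  ξ.up _ hs _ (idem_inv_mul m) h.inv_mul_mul_inv_mul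

theorem NatLE.germ_eq {s m : S} (h : NatLE s m) {ξ : IdemFilter S} (hs : s⁻¹ * s ∈ ξ) :
    germ s ξ hs = germ m ξ (h.inv_mul_mem hs) :=
  (germ_eq_iff _ _).2 ⟨_, hs, by rw [h.mul_inv_mul_eq, ← mul_assoc, mul_inv_mul]⟩

/-- All idempotents of `ξ` have the same germ at `ξ`, so one fixed idempotent suffices as a test.
This exhibits the units in a bisection as an equalizer. -/
theorem germ_mem_units_iff {s : S} {ξ : IdemFilter S} (h : s⁻¹ * s ∈ ξ) :
    germ s ξ h ∈ UnivGroupoid.units ↔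
      germ s ξ h = germ (s⁻¹ * s) ξ (by rwa [inv_mul_self_of_idem (idem_inv_mul s)]) := by
  constructor
  · rintro ⟨e, ζ, he, hei, heq⟩
    obtain rfl : ξ = ζ := congrArg UnivGroupoid.source heq
    rw [heq]
    have he' : e ∈ ξ := by rwa [inv_mul_self_of_idem hei] at he
    refine (germ_eq_iff _ _).2 ⟨e * (s⁻¹ * s), ξ.mul_mem _ he' _ h, ?_⟩
    rw [← mul_assoc, hei.eq, idem_comm hei (idem_inv_mul s), ← mul_assoc, (idem_inv_mul s).eq]
  · intro heq
    exact ⟨_, _, _, idem_inv_mul s, heq⟩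

theorem germ_mem_units {e : S} (he : IsIdempotentElem e) {ξ : IdemFilter S}
    (h : e⁻¹ * e ∈ ξ) : germ e ξ h ∈ UnivGroupoid.units :=
  ⟨e, ξ, h, he, rfl⟩

/-- The germ of `s` at the principal filter of `s⁻¹ s`. -/
def principalGerm (s : S) : UnivGroupoid S :=
  germ s (principal (s⁻¹ * s) (idem_inv_mul s)) (self_mem_principal _)

/-- Each `e` in the principal filter lies above `s⁻¹ * s`, so agreement of `s` and `m` on `e`
restricts to agreement on `s⁻¹ * s`. -/
theorem natLE_of_principalGerm_eq {s m : S} {ξ : IdemFilter S} {h : m⁻¹ * m ∈ ξ}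
    (heq : principalGerm s = germ m ξ h) : NatLE s m := by
  obtain rfl : principal (s⁻¹ * s) (idem_inv_mul s) = ξ := congrArg UnivGroupoid.source heq
  obtain ⟨e, ⟨hei, he⟩, hse⟩ := (germ_eq_iff _ _).1 heq
  refine natLE_of_mul_idem (idem_inv_mul s) ?_
  rw [← he, idem_comm (idem_inv_mul s) hei, ← mul_assoc, ← hse, mul_assoc,
    ← idem_comm (idem_inv_mul s) hei, he, ← mul_assoc, mul_inv_mul]

theorem principalGerm_mem_units_iff (s : S) :
    principalGerm s ∈ UnivGroupoid.units ↔ IsIdempotentElem s := by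
  refine ⟨?_, fun h => germ_mem_units h _⟩
  rintro ⟨e, ξ, h, he, heq⟩
  rw [← (natLE_of_principalGerm_eq heq).mul_inv_mul_eq]
  exact idem_mul he (idem_inv_mul s)

/-! ### The topology of the universal groupoid -/

/-- The map `ξ ↦ [s, ξ]` on `D_{s⁻¹s}`. -/
def germMap (s : S) (ξ : {ξ : IdemFilter S // s⁻¹ * s ∈ ξ}) : UnivGroupoid S :=
  germ s ξ.1 ξ.2

theorem isOpenMap_germMap (s : S) : IsOpenMap (germMap s) := by
  rintro U ⟨V, hV, rfl⟩
  refine TopologicalSpace.isOpen_generateFrom_of_mem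
    ⟨s, V ∩ {ξ | s⁻¹ * s ∈ ξ}, fun ξ h => h.2, hV.inter (isOpen_setOf_mem _), ?_⟩
  ext g
  constructor
  · rintro ⟨⟨ξ, h⟩, hξ, rfl⟩
    exact ⟨ξ, ⟨hξ, h⟩, rfl⟩
  · rintro ⟨ξ, ⟨hξ, h⟩, rfl⟩
    exact ⟨⟨ξ, h⟩, hξ, rfl⟩

/-- An idempotent `e` witnessing equality of two germs at `ξ` witnesses it at every filter
containing `e`, and these form an open set. -/
theorem continuous_germMap (s : S) : Continuous (germMap s) := by
  refine continuous_generateFrom_iff.2 ?_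
  rintro _ ⟨t, U, hU, hUo, rfl⟩
  rw [isOpen_iff_mem_nhds]
  rintro ⟨ξ, hs⟩ ⟨ζ, hζ, heq⟩
  obtain rfl : ξ = ζ := congrArg UnivGroupoid.source heq
  obtain ⟨e, he, hse⟩ := (germ_eq_iff _ _).1 heq
  have ho := (hUo.inter (isOpen_setOf_mem e)).preimage
    (continuous_subtype_val (p := fun ξ : IdemFilter S => s⁻¹ * s ∈ ξ))
  refine Filter.mem_of_superset (ho.mem_nhds ⟨hζ, he⟩) ?_
  rintro ⟨η, hη⟩ ⟨hηU, hηe⟩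
  exact ⟨η, hηU, (germ_eq_iff _ _).2 ⟨e, hηe, hse⟩⟩

/-- The compact open bisection `{[s, ξ] | ξ ∈ D_{s⁻¹s}}`. -/
def bisection (s : S) : Set (UnivGroupoid S) := range (germMap s)

theorem germ_mem_bisection {s : S} {ξ : IdemFilter S} (h : s⁻¹ * s ∈ ξ) :
    germ s ξ h ∈ bisection s := ⟨⟨ξ, h⟩, rfl⟩

theorem isOpen_bisection (s : S) : IsOpen (bisection s) := (isOpenMap_germMap s).isOpen_range

theorem isCompact_bisection (s : S) : IsCompact (bisection s) := by
  have : CompactSpace {ξ : IdemFilter S // s⁻¹ * s ∈ ξ} :=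
    isCompact_iff_compactSpace.1 (isCompact_setOf_mem (s⁻¹ * s))
  exact isCompact_range (continuous_germMap s)

/-- The set `T` prescribes where the covering elements come from: everything for control and
properness, the elements of length at most `r` for tight properness. -/
theorem exists_finset_bisection_cover {K : Set (UnivGroupoid S)} (hK : IsCompact K) (T : Set S)
    (hT : ∀ g ∈ K, ∃ s ∈ T, g ∈ bisection s) :
    ∃ F : Finset S, (∀ s ∈ F, s ∈ T) ∧ ∀ g ∈ K, ∃ s ∈ F, g ∈ bisection s := by
  classical
  obtain ⟨F, hF⟩ := hK.elim_finite_subcover (fun s : T => bisection (s : S))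
    (fun s => isOpen_bisection _) fun g hg => by
      obtain ⟨s, hs, hgs⟩ := hT g hg
      exact mem_iUnion.2 ⟨⟨s, hs⟩, hgs⟩
  refine ⟨F.image Subtype.val, fun s hs => ?_, fun g hg => ?_⟩
  · obtain ⟨t, -, rfl⟩ := Finset.mem_image.1 hs
    exact t.2
  · obtain ⟨s, hs, hgs⟩ := mem_iUnion₂.1 (hF hg)
    exact ⟨s, Finset.mem_image_of_mem _ hs, hgs⟩

theorem isOpen_units : IsOpen (UnivGroupoid.units : Set (UnivGroupoid S)) := by
  have : (UnivGroupoid.units : Set (UnivGroupoid S)) =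
      ⋃ e : {e : S // IsIdempotentElem e}, bisection e.1 := by
    ext g
    simp only [mem_iUnion]
    constructor
    · rintro ⟨e, ξ, h, he, rfl⟩
      exact ⟨⟨e, he⟩, germ_mem_bisection h⟩
    · rintro ⟨⟨e, he⟩, ⟨ξ, h⟩, rfl⟩
      exact germ_mem_units he h
  rw [this]
  exact isOpen_iUnion fun e => isOpen_bisection _

theorem isClosed_bisection [T2Space (UnivGroupoid S)]
    (s : S) : IsClosed (bisection s) := (isCompact_bisection s).isClosed

/-- On each bisection the units are the equalizer of two continuous maps into a Hausdorff space, and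
openness of `germMap` carries the complement into the groupoid. -/
theorem isClosed_units [T2Space (UnivGroupoid S)]
    : IsClosed (UnivGroupoid.units : Set (UnivGroupoid S)) := by
  have key (s : S) : IsClosed (germMap s ⁻¹' UnivGroupoid.units) := by
    have hc : Continuous fun ξ : {ξ : IdemFilter S // s⁻¹ * s ∈ ξ} =>
        germMap (s⁻¹ * s) ⟨ξ.1, by rw [inv_mul_self_of_idem (idem_inv_mul s)]; exact ξ.2⟩ :=
      (continuous_germMap _).comp (continuous_subtype_val.subtype_mk _)
    convert isClosed_eq (continuous_germMap s) hc using 1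
    ext ξ
    exact germ_mem_units_iff ξ.2
  have : (UnivGroupoid.units : Set (UnivGroupoid S))ᶜ =
      ⋃ s : S, germMap s '' (germMap s ⁻¹' UnivGroupoid.units)ᶜ := by
    ext g
    simp only [mem_iUnion]
    constructor
    · intro hg
      obtain ⟨s, ξ, h, rfl⟩ := exists_eq_germ g
      exact ⟨s, ⟨ξ, h⟩, hg, rfl⟩
    · rintro ⟨s, ξ, hξ, rfl⟩
      exact hξ
  rw [← isOpen_compl_iff, this]
  exact isOpen_iUnion fun s => isOpenMap_germMap s _ (key s).isOpen_compl

/-! ### The map `Φ` -/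

theorem Phi_germ_le (l : S → ℝ≥0) {t : S} {ξ : IdemFilter S} (h : t⁻¹ * t ∈ ξ) :
    Phi l (germ t ξ h) ≤ l t :=
  csInf_le (OrderBot.bddBelow _) ⟨t, h, rfl, rfl⟩

theorem Phi_le_of_mem_bisection (l : S → ℝ≥0) {t : S} {g : UnivGroupoid S}
    (h : g ∈ bisection t) : Phi l g ≤ l t := by
  obtain ⟨ξ, rfl⟩ := h
  exact Phi_germ_le l ξ.2

theorem Phi_set_nonempty (l : S → ℝ≥0) (g : UnivGroupoid S) :
    {r | ∃ (t : S) (h : t⁻¹ * t ∈ g.source), germ t g.source h = g ∧ r = l t}.Nonempty := by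
  obtain ⟨s, ξ, h, rfl⟩ := exists_eq_germ g
  exact ⟨l s, s, h, rfl, rfl⟩

theorem exists_germ_lt {l : S → ℝ≥0} {g : UnivGroupoid S} {a : ℝ≥0} (h : Phi l g < a) :
    ∃ t ξ h, g = germ t ξ h ∧ l t < a := by
  obtain ⟨_, ⟨t, ht, htg, rfl⟩, hlt⟩ := exists_lt_of_csInf_lt (Phi_set_nonempty l g) h
  exact ⟨t, _, ht, htg.symm, hlt⟩

theorem le_Phi {l : S → ℝ≥0} {g : UnivGroupoid S} {a : ℝ≥0}
    (h : ∀ t ξ (ht : t⁻¹ * t ∈ ξ), g = germ t ξ ht → a ≤ l t) : a ≤ Phi l g := by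
  refine le_csInf (Phi_set_nonempty l g) ?_
  rintro _ ⟨t, ht, htg, rfl⟩
  exact h t _ ht htg.symm

/-- An element below `t` is `t` times an idempotent, which has length zero. -/
theorem IsLength.le_of_natLE {l : S → ℝ≥0} (hl : IsLength l) {s t : S} (h : NatLE s t) :
    l s ≤ l t := by
  have := hl.mul_le t (s⁻¹ * s)
  rwa [h.mul_inv_mul_eq, (hl.eq_zero_iff _).2 (idem_inv_mul s), add_zero] at this

theorem IsLength.Phi_principalGerm {l : S → ℝ≥0} (hl : IsLength l) (s : S) :
    Phi l (principalGerm s) = l s :=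
  le_antisymm (Phi_germ_le l _) <|
    le_Phi fun _ _ _ h => hl.le_of_natLE (natLE_of_principalGerm_eq h)

theorem IsLength.Phi_eq_zero {l : S → ℝ≥0} (hl : IsLength l) {g : UnivGroupoid S}
    (hg : g ∈ UnivGroupoid.units) : Phi l g = 0 := by
  obtain ⟨e, ξ, h, he, rfl⟩ := hg
  exact le_antisymm ((Phi_germ_le l h).trans ((hl.eq_zero_iff e).2 he).le) zero_le

theorem le_Phi_of_notMem_units {l : S → ℝ≥0} {c : ℝ≥0}
    (hc : ∀ s, ¬ IsIdempotentElem s → c ≤ l s) {g : UnivGroupoid S}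
    (hg : g ∉ UnivGroupoid.units) : c ≤ Phi l g := by
  refine le_Phi fun t ξ ht htg => hc t fun hti => hg ?_
  rw [htg]
  exact germ_mem_units hti ht

theorem IsLength.Phi_inv_le {l : S → ℝ≥0} (hl : IsLength l) (g : UnivGroupoid S) :
    Phi l g⁻¹ ≤ Phi l g := by
  refine le_Phi fun t ξ ht htg => ?_
  rw [htg, inv_germ, ← hl.inv t]
  exact Phi_germ_le l _

theorem IsLength.Phi_mul_le {l : S → ℝ≥0} (hl : IsLength l) {g h : UnivGroupoid S}
    (hgh : g.source = h.range) : Phi l (g * h) ≤ Phi l g + Phi l h := by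
  refine le_of_forall_pos_le_add fun ε hε => ?_
  obtain ⟨s, ξ, hs, rfl, hls⟩ := exists_germ_lt (lt_add_of_pos_right (Phi l g) (half_pos hε))
  obtain ⟨t, ζ, ht, rfl, hlt⟩ := exists_germ_lt (lt_add_of_pos_right (Phi l h) (half_pos hε))
  obtain rfl : ξ = theta t ζ := hgh
  rw [UnivGroupoid.germ_mul_germ]
  calc Phi l (germ (s * t) ζ _) ≤ l (s * t) := Phi_germ_le l _
    _ ≤ l s + l t := hl.mul_le s t
    _ ≤ (Phi l (germ s (theta t ζ) hs) + ε / 2) + (Phi l (germ t ζ ht) + ε / 2) :=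
        add_le_add hls.le hlt.le
    _ = _ := by rw [add_add_add_comm, add_halves]

/-- Uniform discreteness prevents an infimum of positive lengths from vanishing at a non-unit. -/
theorem IsLength.isLength_Phi {l : S → ℝ≥0} (hl : IsLength l) (hd : UniformlyDiscrete l) :
    UnivGroupoid.IsLength (Phi l) where
  eq_zero_iff g := by
    refine ⟨fun h => ?_, hl.Phi_eq_zero⟩
    obtain ⟨c, hc, hcl⟩ := hd
    by_contra hg
    exact hc.not_ge (h ▸ le_Phi_of_notMem_units hcl hg)
  inv g := le_antisymm (hl.Phi_inv_le g) <| by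
    simpa only [UnivGroupoid.inv_inv] using hl.Phi_inv_le g⁻¹
  mul_le _ _ := hl.Phi_mul_le

theorem UniformlyDiscrete.Phi {l : S → ℝ≥0} (hd : UniformlyDiscrete l) :
    UnivGroupoid.UniformlyDiscrete (Phi l) := by
  obtain ⟨c, hc, hcl⟩ := hd
  exact ⟨c, hc, fun g hg => le_Phi_of_notMem_units hcl hg⟩

theorem controlled_Phi (l : S → ℝ≥0) : UnivGroupoid.Controlled (Phi l) := by
  intro K hK
  obtain ⟨F, -, hF⟩ := exists_finset_bisection_cover hK univ fun g _ => by
    obtain ⟨s, ξ, h, rfl⟩ := exists_eq_germ g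
    exact ⟨s, mem_univ s, germ_mem_bisection h⟩
  refine ⟨F.sup l, ?_⟩
  rintro _ ⟨g, hg, rfl⟩
  obtain ⟨s, hs, hgs⟩ := hF g (subset_closure hg)
  exact (Phi_le_of_mem_bisection l hgs).trans (Finset.le_sup hs)

/-! ### The map `Ψ` -/

/-- The supremum is attained at the principal filter of `s⁻¹ * s`. -/
theorem IsLength.Psi_Phi {l : S → ℝ≥0} (hl : IsLength l) : Psi (Phi l) = l := by
  funext s
  let ξ₀ : {ξ : IdemFilter S // s⁻¹ * s ∈ ξ} :=
    ⟨principal (s⁻¹ * s) (idem_inv_mul s), self_mem_principal _⟩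
  have : Nonempty {ξ : IdemFilter S // s⁻¹ * s ∈ ξ} := ⟨ξ₀⟩
  have hle (ξ : {ξ : IdemFilter S // s⁻¹ * s ∈ ξ}) : Phi l (germ s ξ.1 ξ.2) ≤ l s :=
    Phi_germ_le l ξ.2
  refine le_antisymm (ciSup_le hle) ?_
  rw [← hl.Phi_principalGerm s]
  exact le_ciSup (f := fun ξ : {ξ : IdemFilter S // s⁻¹ * s ∈ ξ} => Phi l (germ s ξ.1 ξ.2))
    ⟨l s, forall_mem_range.2 hle⟩ ξ₀

theorem injOn_Phi : InjOn (Phi (S := S)) {l | IsLength l} := fun l hl l' hl' h => by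
  rw [← IsLength.Psi_Phi hl, h, IsLength.Psi_Phi hl']

variable {L : UnivGroupoid S → ℝ≥0}

theorem UnivGroupoid.Controlled.bddAbove [T2Space (UnivGroupoid S)]
    (hL : UnivGroupoid.Controlled L) (s : S) :
    BddAbove (Set.range fun ξ : {ξ : IdemFilter S // s⁻¹ * s ∈ ξ} => L (germ s ξ.1 ξ.2)) := by
  have := hL (bisection s) (isCompact_bisection s).closure
  rwa [bisection, ← range_comp] at this

theorem UnivGroupoid.Controlled.le_Psi [T2Space (UnivGroupoid S)]
    (hL : UnivGroupoid.Controlled L) {s : S}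
    {ξ : IdemFilter S} (h : s⁻¹ * s ∈ ξ) : L (germ s ξ h) ≤ Psi L s :=
  le_ciSup (hL.bddAbove s) ⟨ξ, h⟩

theorem Psi_le {s : S} {a : ℝ≥0}
    (h : ∀ ξ (hs : s⁻¹ * s ∈ ξ), L (germ s ξ hs) ≤ a) : Psi L s ≤ a :=
  ciSup_le' fun ξ => h ξ.1 ξ.2

theorem UnivGroupoid.IsLength.Psi_inv_le [T2Space (UnivGroupoid S)] (hL : UnivGroupoid.IsLength L)
    (hc : UnivGroupoid.Controlled L) (s : S) : Psi L s ≤ Psi L s⁻¹ := by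
  refine Psi_le fun ξ hs => ?_
  rw [← hL.inv, inv_germ]
  exact hc.le_Psi _

theorem UnivGroupoid.IsLength.isLength_Psi [T2Space (UnivGroupoid S)] (hL : UnivGroupoid.IsLength L)
    (hc : UnivGroupoid.Controlled L) : InverseSemigroup.IsLength (Psi L) where
  eq_zero_iff s := by
    constructor
    · intro h
      rw [← principalGerm_mem_units_iff, ← hL.eq_zero_iff]
      exact le_antisymm (h ▸ hc.le_Psi _) zero_le
    · intro hs
      exact le_antisymm (Psi_le fun ξ h => ((hL.eq_zero_iff _).2 (germ_mem_units hs h)).le) zero_le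
  inv s := le_antisymm (by simpa only [inv_inv'] using hL.Psi_inv_le hc s⁻¹) (hL.Psi_inv_le hc s)
  mul_le s t := by
    refine Psi_le fun ξ h => ?_
    have ht := mem_of_mul_mem h
    have hs := mem_theta_of_mul_mem h
    rw [← UnivGroupoid.germ_mul_germ s t ξ ht hs]
    exact (hL.mul_le _ _ rfl).trans (add_le_add (hc.le_Psi hs) (hc.le_Psi ht))

theorem UnivGroupoid.UniformlyDiscrete.Psi [T2Space (UnivGroupoid S)]
    (hd : UnivGroupoid.UniformlyDiscrete L)
    (hc : UnivGroupoid.Controlled L) : InverseSemigroup.UniformlyDiscrete (Psi L) := by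
  obtain ⟨c, hc0, hcL⟩ := hd
  refine ⟨c, hc0, fun s hs => ?_⟩
  exact (hcL (principalGerm s) (mt (principalGerm_mem_units_iff s).1 hs)).trans (hc.le_Psi _)

/-! ### Properness -/

/-- The bound on `Phi l g` is strict because the infimum need not be attained: strictness provides a
representative of length below `r`. -/
theorem Witnesses.mem_bisection {l : S → ℝ≥0} (hl : IsLength l) {r : ℝ≥0} {F : Finset S}
    (hF : Witnesses l r F) {g : UnivGroupoid S} (hg : g ∉ UnivGroupoid.units)
    (hr : Phi l g < r) : ∃ m ∈ F, g ∈ bisection m := by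
  obtain ⟨t, ξ, ht, rfl, hlt⟩ := exists_germ_lt hr
  have h0 : 0 < l t := pos_iff_ne_zero.2 fun h => hg (germ_mem_units ((hl.eq_zero_iff t).1 h) ht)
  obtain ⟨m, hm, htm⟩ := hF t h0 hlt.le
  exact ⟨m, hm, htm.germ_eq ht ▸ germ_mem_bisection _⟩

theorem Proper.Phi [T2Space (UnivGroupoid S)] {l : S → ℝ≥0} (hl : IsLength l) (hp : Proper l) :
    UnivGroupoid.Proper (Phi l) := by
  rintro K hK ⟨r, hr⟩
  -- Any level above `r` would do; it gives the strict inequality needed for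
  -- `Witnesses.mem_bisection`.
  obtain ⟨F, hF⟩ := hp (r + 1)
  refine IsCompact.closure_of_subset (F.isCompact_biUnion fun m _ => isCompact_bisection m) ?_
  intro g hg
  have hgr : InverseSemigroup.Phi l g < r + 1 :=
    (hr (mem_image_of_mem _ hg)).trans_lt (lt_add_of_pos_right r one_pos)
  obtain ⟨m, hm, hgm⟩ := hF.mem_bisection hl (hK hg) hgr
  exact mem_iUnion₂.2 ⟨m, hm, hgm⟩

/-- A bisection of `m` that contains the principal germ of `s` forces `s ≤ m`, so covering principal
germs is enough. -/
theorem IsLength.witnesses_of_cover {l : S → ℝ≥0} (hl : IsLength l) {r : ℝ≥0} {F : Finset S}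
    (hF : ∀ g : UnivGroupoid S, g ∉ UnivGroupoid.units → Phi l g ≤ r →
      ∃ m ∈ F, g ∈ bisection m) : Witnesses l r F := by
  intro s hs hsr
  have hsu : principalGerm s ∉ UnivGroupoid.units := fun h =>
    hs.ne' ((hl.eq_zero_iff s).2 ((principalGerm_mem_units_iff s).1 h))
  obtain ⟨m, hm, ξ, hξ⟩ := hF _ hsu ((hl.Phi_principalGerm s).trans_le hsr)
  exact ⟨m, hm, natLE_of_principalGerm_eq hξ.symm⟩

theorem UnivGroupoid.Proper.isCompact_closure {l : S → ℝ≥0}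
    (hp : UnivGroupoid.Proper (InverseSemigroup.Phi l)) (r : ℝ≥0) :
    IsCompact (closure {g : UnivGroupoid S | g ∉ UnivGroupoid.units ∧ Phi l g ≤ r}) := by
  refine hp _ (fun g hg => hg.1) ⟨r, ?_⟩
  rintro _ ⟨g, hg, rfl⟩
  exact hg.2

theorem IsLength.proper_of_Phi {l : S → ℝ≥0} (hl : IsLength l)
    (hp : UnivGroupoid.Proper (Phi l)) : Proper l := by
  intro r
  obtain ⟨F, -, hF⟩ := exists_finset_bisection_cover (hp.isCompact_closure r) univ fun g _ => by
    obtain ⟨s, ξ, h, rfl⟩ := exists_eq_germ g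
    exact ⟨s, mem_univ s, germ_mem_bisection h⟩
  exact ⟨F, hl.witnesses_of_cover fun g hg hgr => hF g (subset_closure ⟨hg, hgr⟩)⟩

theorem TightlyProper.proper {l : S → ℝ≥0} (ht : TightlyProper l) : Proper l := fun r =>
  (ht r).imp fun _ h => h.1

theorem upperSemicontinuous_Phi (l : S → ℝ≥0) : UpperSemicontinuous (Phi l) := by
  intro g a ha
  obtain ⟨t, ξ, ht, rfl, hlt⟩ := exists_germ_lt ha
  filter_upwards [(isOpen_bisection t).mem_nhds (germ_mem_bisection ht)] with h hh
  exact (Phi_le_of_mem_bisection l hh).trans_lt hlt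

theorem TightlyProper.continuous_Phi [T2Space (UnivGroupoid S)]
    {l : S → ℝ≥0} (hl : IsLength l) (ht : TightlyProper l) :
    Continuous (Phi l) := by
  refine continuous_iff_lower_upperSemicontinuous.2
    ⟨lowerSemicontinuous_iff_isClosed_preimage.2 fun r => ?_, upperSemicontinuous_Phi l⟩
  choose F hF hFl using ht
  -- Witnesses at each level `r' > r` give one inclusion. Tightness gives the other: `Phi l ≤ r'` on
  -- the bisections from `F r'`, and `r'` decreases to `r`.
  have : Phi l ⁻¹' Iic r = UnivGroupoid.units ∪ ⋂ r' > r, ⋃ m ∈ F r', bisection m := by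
    ext g
    simp only [mem_preimage, mem_Iic, mem_union, mem_iInter, mem_iUnion]
    constructor
    · refine fun hg => or_iff_not_imp_left.2 fun hgu r' hr' => ?_
      obtain ⟨m, hm, hgm⟩ := (hF r').mem_bisection hl hgu (hg.trans_lt hr')
      exact ⟨m, hm, hgm⟩
    · rintro (hg | hg)
      · exact (hl.Phi_eq_zero hg).trans_le zero_le
      · refine le_of_forall_gt_imp_ge_of_dense fun r' hr' => ?_
        obtain ⟨m, hm, hgm⟩ := hg r' hr'
        exact (Phi_le_of_mem_bisection l hgm).trans (hFl r' m hm)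
  rw [this]
  exact isClosed_units.union <| isClosed_biInter fun r' _ =>
    isClosed_biUnion_finset fun m _ => isClosed_bisection m

theorem DiscreteValues.exists_eq_Phi {l : S → ℝ≥0} (hd : DiscreteValues l)
    (g : UnivGroupoid S) : ∃ t ξ h, g = germ t ξ h ∧ l t = Phi l g := by
  set A := {r | ∃ (t : S) (h : t⁻¹ * t ∈ g.source), germ t g.source h = g ∧ r = l t}
  -- Cutting off strictly above the infimum leaves a nonempty finite set of values, whose minimum is
  -- the infimum of `A`.
  have hfin : (A ∩ Iic (Phi l g + 1)).Finite := by
    refine (hd (Phi l g + 1)).subset ?_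
    rintro _ ⟨⟨t, h, -, rfl⟩, ht⟩
    exact ⟨mem_range_self t, ht⟩
  obtain ⟨t₀, ξ₀, h₀, hg₀, hlt₀⟩ := exists_germ_lt (lt_add_of_pos_right (Phi l g) one_pos)
  subst hg₀
  obtain ⟨b, ⟨⟨t, ht, htg, rfl⟩, hb⟩, hmin⟩ :=
    hfin.exists_minimal ⟨l t₀, ⟨t₀, h₀, rfl, rfl⟩, hlt₀.le⟩
  refine ⟨t, _, ht, htg.symm, le_antisymm (le_Phi fun u ζ hu hug => ?_) ?_⟩
  · obtain rfl : ξ₀ = ζ := congrArg UnivGroupoid.source hug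
    rcases le_total (l u) (l t) with h | h
    · exact hmin ⟨⟨u, hu, hug.symm, rfl⟩, h.trans hb⟩ h
    · exact h
  · exact Phi_le_of_mem_bisection l (htg ▸ germ_mem_bisection ht)

theorem IsLength.tightlyProper_of_Phi {l : S → ℝ≥0} (hl : IsLength l) (hd : DiscreteValues l)
    (hp : UnivGroupoid.Proper (Phi l)) (hc : Continuous (Phi l)) : TightlyProper l := by
  intro r
  -- Continuity makes this set its own closure, so `Phi l ≤ r` holds at every point to be covered
  -- and an attaining representative has length at most `r`.
  have hclosed : IsClosed {g : UnivGroupoid S | g ∉ UnivGroupoid.units ∧ Phi l g ≤ r} :=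
    isOpen_units.isClosed_compl.inter (isClosed_Iic.preimage hc)
  have hcomp := hp.isCompact_closure r
  rw [hclosed.closure_eq] at hcomp
  obtain ⟨F, hFr, hF⟩ := exists_finset_bisection_cover hcomp {t | l t ≤ r} fun g hg => by
    obtain ⟨t, ξ, h, rfl, ht⟩ := hd.exists_eq_Phi g
    exact ⟨t, ht.trans_le hg.2, germ_mem_bisection h⟩
  exact ⟨F, hl.witnesses_of_cover fun g hg hgr => hF g ⟨hg, hgr⟩, hFr⟩

end InverseSemigroup

open InverseSemigroup in
theorem theorem3p27 {S : Type*} [InverseSemigroup S] (hS : QuasiCountable S)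
    [T2Space (UnivGroupoid S)] :
    -- `Φ` maps length functions of `S` to controlled length functions of the groupoid
    (∀ l : S → ℝ≥0, IsLength l → UniformlyDiscrete l →
      UnivGroupoid.IsLength (Phi l) ∧ UnivGroupoid.UniformlyDiscrete (Phi l)) ∧
    (∀ l : S → ℝ≥0, IsLength l → UnivGroupoid.Controlled (Phi l)) ∧
    -- `Φ` is injective
    Set.InjOn (Phi (S := S)) {l | IsLength l} ∧
    -- `Ψ` (whose suprema are finite) maps controlled length functions to length functions
    (∀ L : UnivGroupoid S → ℝ≥0, UnivGroupoid.Controlled L → ∀ s : S,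
      BddAbove (Set.range fun ξ : {ξ : IdemFilter S // s⁻¹ * s ∈ ξ} => L (germ s ξ.1 ξ.2))) ∧
    (∀ L : UnivGroupoid S → ℝ≥0, UnivGroupoid.IsLength L → UnivGroupoid.Controlled L →
      IsLength (Psi L) ∧ (UnivGroupoid.UniformlyDiscrete L → UniformlyDiscrete (Psi L))) ∧
    -- `Ψ` is a left inverse of `Φ`
    (∀ l : S → ℝ≥0, IsLength l → Psi (Phi l) = l) ∧
    -- properness
    (∀ l : S → ℝ≥0, IsLength l → (Proper l ↔ UnivGroupoid.Proper (Phi l))) ∧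
    -- tight properness
    (∀ l : S → ℝ≥0, IsLength l → TightlyProper l →
      UnivGroupoid.Proper (Phi l) ∧ Continuous (Phi l)) ∧
    (∀ l : S → ℝ≥0, IsLength l → DiscreteValues l →
      (TightlyProper l ↔ UnivGroupoid.Proper (Phi l) ∧ Continuous (Phi l))) := by
  refine ⟨fun l hl hd => ⟨hl.isLength_Phi hd, hd.Phi⟩, fun l _ => controlled_Phi l, injOn_Phi,
    fun L hL s => UnivGroupoid.Controlled.bddAbove hL s,
    fun L hL hc => ⟨hL.isLength_Psi hc, fun hd => hd.Psi hc⟩,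
    fun l hl => hl.Psi_Phi, fun l hl => ⟨Proper.Phi hl, hl.proper_of_Phi⟩,
    fun l hl ht => ⟨ht.proper.Phi hl, ht.continuous_Phi hl⟩,
    fun l hl hd => ⟨fun ht => ⟨ht.proper.Phi hl, ht.continuous_Phi hl⟩,
      fun h => hl.tightlyProper_of_Phi hd h.1 h.2⟩⟩
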